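/- Let $0<q<1$, write $(a;q)_m=\prod_{j=0}^{m-1}(1-aq^j)$, and let $$\tilde p_n(x;\alpha,\beta|q)=(-1)^nq^{\binom n2}\frac{(\alpha q;q)_n}{(\alpha\beta q^{n+1};q)_n}\sum_{m=0}^{n}\frac{(q^{-n};q)_m(\alpha\beta q^{n+1};q)_m}{(\alpha q;q)_m(q;q)_m}(qx)^m$$ be the monic little $q$-Jacobi polynomial of degree $n$. Let $\alpha,\beta\in\mathbb R$ with $0<\alpha q<1$ and $0<\beta q<1$, and let $n\ge 1$; if $n=1$, assume in addition that $\alpha\beta q<1$. Then $\tilde p_n(x;\alpha,\beta|q)$ has $n$ real distinct zeros $x_{n,1}<\dots<x_{n,n}$, $\tilde p_{n-1}(x;\alpha,\beta|q)$ has $n-1$ real distinct zeros $x_{n-1,1}<\dots<x_{n-1,n-1}$, and the following hold. (i) If $\alpha>1$, then $\tilde p_n(x;\alpha/q,\beta|q)$ has degree $n$ and $n$ real distinct zeros $y_{n,1}<\dots<y_{n,n}$, and $$y_{n,1}<0<x_{n,1}<x_{n-1,1}<y_{n,2}<x_{n,2}<x_{n-1,2}<\cdots<x_{n-1,n-1}<y_{n,n}<x_{n,n}<1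 ,$$ that is, $y_{n,1}<0<x_{n,1}$, $y_{n,j}<x_{n,j}$ for $1\le j\le n$, $x_{n,j}<x_{n-1,j}<y_{n,j+1}$ for $1\le j\le n-1$, and $x_{n,n}<1$. (ii) If $\beta>1$, then $\tilde p_n(x;\alpha,\beta/q|q)$ has degree $n$ and $n$ real distinct zeros $z_{n,1}<\dots<z_{n,n}$, and $$0<x_{n,1}<z_{n,1}<x_{n-1,1}<x_{n,2}<z_{n,2}<x_{n-1,2}<\cdots<x_{n-1,n-1}<x_{n,n}<1<z_{n,n} ,$$ that is, $0<x_{n,1}$, $x_{n,j}<z_{n,j}$ for $1\le j\le n$, $z_{n,j}<x_{n-1,j}<x_{n,j+1}$ for $1\le j\le n-1$, and $x_{n,n}<1<z_{n,n}$. -/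

import Mathlib

open Polynomial

/-- The `q`-Pochhammer symbol `(a; q)_m = ∏_{j=0}^{m-1} (1 - a q^j)`. -/
def qPoch (a q : ℝ) (m : ℕ) : ℝ := ∏ j ∈ Finset.range m, (1 - a * q ^ j)

/-- The basic hypergeometric series `₂φ₁(a, b; c; q; z)`. -/
noncomputable def phi21 (a b c q z : ℝ) : ℝ :=
  ∑' m : ℕ, qPoch a q m * qPoch b q m / qPoch c q m * (z ^ m / qPoch q q m)

/-- The monic little `q`-Jacobi polynomial of degree `n`,
`(-1)^n q^(n choose 2) (αq; q)_n / (αβ q q^n; q)_n * ₂φ₁(q^(-n), αβ q^(n+1); αq; q; q x)`,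
as a polynomial in `x`.  The series stops at `m = n` because `(q^(-n); q)_m = 0` for `m > n`;
see `littleQJacobi_eval`. -/
noncomputable def littleQJacobi (q α β : ℝ) (n : ℕ) : ℝ[X] :=
  C ((-1) ^ n * q ^ n.choose 2 * qPoch (α * q) q n / qPoch (α * β * q * q ^ n) q n) *
    ∑ m ∈ Finset.range (n + 1),
      C (qPoch (q ^ n)⁻¹ q m * qPoch (α * β * q ^ (n + 1)) q m / qPoch (α * q) q m *
        (q ^ m / qPoch q q m)) * X ^ m

theorem littleQJacobi_eval (q α β : ℝ) (hq : q ≠ 0) (n : ℕ) (x : ℝ) :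
    (littleQJacobi q α β n).eval x =
      (-1) ^ n * q ^ n.choose 2 * qPoch (α * q) q n / qPoch (α * β * q * q ^ n) q n *
        phi21 (q ^ n)⁻¹ (α * β * q ^ (n + 1)) (α * q) q (q * x) := by
  unfold littleQJacobi phi21
  rw [tsum_eq_sum (s := Finset.range (n + 1))]
  · simp only [eval_mul, eval_C, eval_finsetSum, eval_pow, eval_X]
    congr 1
    refine Finset.sum_congr rfl fun m _ => ?_
    rw [mul_pow]
    ring
  · intro m hm
    have hnm : n < m := by
      rw [Finset.mem_range] at hm
      omega
    have h0 : qPoch (q ^ n)⁻¹ q m = 0 := by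
      refine Finset.prod_eq_zero (Finset.mem_range.2 hnm) ?_
      rw [inv_mul_cancel₀ (pow_ne_zero n hq), sub_self]
    rw [h0]
    simp

/-- `x 1 < x 2 < ⋯ < x n` are the zeros of the polynomial `p` of degree `n`: `p` has exactly `n`
(complex) zeros, they are real and distinct, and they are listed in increasing order.
Only the values `x 1, …, x n` matter. -/
structure AreOrderedZeros (p : ℝ[X]) (n : ℕ) (x : ℕ → ℝ) : Prop where
  natDegree_eq : p.natDegree = n
  strictMonoOn : StrictMonoOn x (Set.Icc 1 n)
  zero_iff : ∀ t : ℂ, aeval t p = 0 ↔ ∃ j ∈ Set.Icc 1 n, t = (x j : ℂ)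

/-! Write `p_n` for the monic polynomial with parameters `α, β`. Everything rests on a contiguous
relation: replacing `α` by `α / q`, or `β` by `β / q`, turns `p_n` into `p_n + c * p_{n-1}` with an
explicit constant `c` (`littleQJacobi_div_left`, `littleQJacobi_div_right`).

The three-term recurrence has positive coefficients `A` and `C`, and explicit ratios give the signs
of `p_n` at `0` and `1`. Sign changes then put the zeros in `(0, 1)` and make those of `p_n` and
`p_{n-1}` interlace (`littleQJacobi_interlacing`).

At a zero of `p_n` the combination has the sign of `c * p_{n-1}`, and at a zero of `p_{n-1}` that of
`p_n`. This locates all its zeros but one, on the left of the `x_j` if `c > 0` and on the right if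
`c < 0`. The remaining zero leaves `[0, 1]` because of an endpoint sign: for `α > 1` the value at
`0` is a negative multiple of `p_n(0)`, and for `β > 1` the value at `1` is a negative multiple of
`p_{n-1}(1)`. -/

/-! ### Elementary properties of the `q`-Pochhammer symbol. -/

theorem qPoch_zero (a q : ℝ) : qPoch a q 0 = 1 := by simp [qPoch]

theorem qPoch_succ (a q : ℝ) (m : ℕ) : qPoch a q (m + 1) = qPoch a q m * (1 - a * q ^ m) := by
  simp [qPoch, Finset.prod_range_succ]

theorem qPoch_succ_left (a q : ℝ) (m : ℕ) :
    qPoch a q (m + 1) = (1 - a) * qPoch (a * q) q m := by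
  rw [qPoch, Finset.prod_range_succ', mul_comm, qPoch]
  congr 1
  · simp
  · refine Finset.prod_congr rfl fun j _ => ?_
    ring

theorem qPoch_shift (a q : ℝ) (m : ℕ) :
    (1 - a) * qPoch (a * q) q m = qPoch a q m * (1 - a * q ^ m) := by
  rw [← qPoch_succ_left, qPoch_succ]

theorem qPoch_pos {a q : ℝ} (hq0 : 0 < q) (hq1 : q < 1) (ha0 : 0 < a) (ha1 : a < 1) (m : ℕ) :
    0 < qPoch a q m := by
  refine Finset.prod_pos fun j _ => ?_
  have : a * q ^ j ≤ a * 1 := by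
    gcongr
    exact pow_le_one₀ hq0.le hq1.le
  linarith

theorem qPoch_inv_pow_eq_zero {q : ℝ} (hq : q ≠ 0) {n m : ℕ} (h : n < m) :
    qPoch (q ^ n)⁻¹ q m = 0 :=
  Finset.prod_eq_zero (Finset.mem_range.2 h) <| by
    rw [inv_mul_cancel₀ (pow_ne_zero n hq), sub_self]

/-! ### Coefficients and their recurrence. -/

/-- The constant term of the monic little `q`-Jacobi polynomial. -/
noncomputable def ljConst (q α β : ℝ) (n : ℕ) : ℝ :=
  (-1) ^ n * q ^ n.choose 2 * qPoch (α * q) q n / qPoch (α * β * q * q ^ n) q n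

/-- The coefficients of the little `q`-Jacobi polynomial with constant term `1`. -/
noncomputable def ljCoeff (q α β : ℝ) (n m : ℕ) : ℝ :=
  qPoch (q ^ n)⁻¹ q m * qPoch (α * β * q ^ (n + 1)) q m / qPoch (α * q) q m *
    (q ^ m / qPoch q q m)

theorem ljCoeff_zero (q α β : ℝ) (n : ℕ) : ljCoeff q α β n 0 = 1 := by
  simp [ljCoeff, qPoch_zero]

theorem littleQJacobi_coeff {q : ℝ} (hq : q ≠ 0) (α β : ℝ) (n m : ℕ) :
    (littleQJacobi q α β n).coeff m = ljConst q α β n * ljCoeff q α β n m := by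
  rw [littleQJacobi, coeff_C_mul, finsetSum_coeff]
  simp only [coeff_C_mul_X_pow]
  rw [Finset.sum_ite_eq]
  unfold ljConst ljCoeff
  split_ifs with h
  · rfl
  · rw [qPoch_inv_pow_eq_zero hq (by simpa using h)]
    simp

theorem littleQJacobi_zero (q α β : ℝ) : littleQJacobi q α β 0 = 1 := by
  simp [littleQJacobi, qPoch_zero]

/-- What remains of `ljCoeff_recurrence`, with `N = q ^ (n + 1)` and `M = q ^ m`, once the common
`q`-Pochhammer factors are cancelled. -/
theorem recurrence_identity {q α β N M : ℝ} (hq : q ≠ 0) (hN : N ≠ 0) (hN1 : N - 1 ≠ 0)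
    (h1 : 1 - α * β * q * N ≠ 0) (h2 : 1 - α * β * N ^ 2 ≠ 0) (h3 : 1 - α * β * q * N ^ 2 ≠ 0)
    (h4 : 1 - α * β * q ^ 2 * N ^ 2 ≠ 0) :
    N * (1 - α * q * N) * (1 - α * β * q * N) /
          ((1 - α * β * q * N ^ 2) * (1 - α * β * q ^ 2 * N ^ 2)) *
        (q * (1 - N⁻¹ * M) * (1 - α * β * q * N * M) -
          q * (1 - (N * q)⁻¹) * (1 - α * β * q * N * M) * (1 - α * β * q * N * q * M) /
            (1 - α * β * q * N)) =
      (1 - α * q * M) * (1 - q * M) +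
        α * N * (1 - N) * (1 - β * N) / ((1 - α * β * N ^ 2) * (1 - α * β * q * N ^ 2)) *
          (q * (1 - N⁻¹ * M) * (1 - N⁻¹ * q * M) / (1 - N⁻¹) * (1 - α * β * N) -
            q * (1 - N⁻¹ * M) * (1 - α * β * q * N * M)) := by
  have h0 : 1 - N⁻¹ = (N - 1) / N := by field_simp
  rw [h0]
  -- The denominators become atoms, so that `field_simp` clears them without expanding; they are
  -- restored for `ring`.
  obtain ⟨S1, e1⟩ : ∃ s, s = 1 - α * β * q * N := ⟨_, rfl⟩
  obtain ⟨S2, e2⟩ : ∃ s, s = 1 - α * β * N ^ 2 := ⟨_, rfl⟩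
  obtain ⟨S3, e3⟩ : ∃ s, s = 1 - α * β * q * N ^ 2 := ⟨_, rfl⟩
  obtain ⟨S4, e4⟩ : ∃ s, s = 1 - α * β * q ^ 2 * N ^ 2 := ⟨_, rfl⟩
  rw [← e1] at h1
  rw [← e2] at h2
  rw [← e3] at h3
  rw [← e4] at h4
  rw [← e1, ← e2, ← e3, ← e4]
  field_simp
  subst e1 e2 e3 e4
  ring

/-- Three-term recurrence for the coefficients, with `N = q ^ (n + 1)`. -/
theorem ljCoeff_recurrence {q α β : ℝ} (hq0 : 0 < q) (hq1 : q < 1) (hα0 : 0 < α * q)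
    (hα1 : α * q < 1) {n : ℕ} {N : ℝ} (hN : N = q ^ (n + 1))
    (h1 : 1 - α * β * q * N ≠ 0) (h2 : 1 - α * β * N ^ 2 ≠ 0) (h3 : 1 - α * β * q * N ^ 2 ≠ 0)
    (h4 : 1 - α * β * q ^ 2 * N ^ 2 ≠ 0) (m : ℕ) :
    N * (1 - α * q * N) * (1 - α * β * q * N) /
          ((1 - α * β * q * N ^ 2) * (1 - α * β * q ^ 2 * N ^ 2)) *
        (ljCoeff q α β (n + 1) (m + 1) - ljCoeff q α β (n + 2) (m + 1)) =
      ljCoeff q α β (n + 1) m +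
        α * N * (1 - N) * (1 - β * N) / ((1 - α * β * N ^ 2) * (1 - α * β * q * N ^ 2)) *
          (ljCoeff q α β n (m + 1) - ljCoeff q α β (n + 1) (m + 1)) := by
  have hN0 : 0 < N := hN ▸ pow_pos hq0 _
  have hN1 : N < 1 := hN ▸ pow_lt_one₀ hq0.le hq1 (Nat.succ_ne_zero n)
  set M := q ^ m with hM
  have hM0 : 0 < M := pow_pos hq0 m
  have hM1 : M ≤ 1 := pow_le_one₀ hq0.le hq1.le
  have hf := (qPoch_pos hq0 hq1 hα0 hα1 m).ne'
  have hg := (qPoch_pos hq0 hq1 hq0 hq1 m).ne'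
  have hfm : 1 - α * q * M ≠ 0 := by nlinarith
  have hgm : 1 - q * M ≠ 0 := by nlinarith
  have hNi : 1 - N ≠ 0 := by linarith
  have hNi' : N - 1 ≠ 0 := by linarith
  -- Bases that differ by a power of `q` are brought to the common bases `N⁻¹` and `D`, at the cost
  -- of a few linear factors.
  have e1 : qPoch (q ^ (n + 2))⁻¹ q (m + 1) = (1 - (N * q)⁻¹) * qPoch N⁻¹ q m := by
    rw [qPoch_succ_left, pow_succ q (n + 1), ← hN]
    congr 2
    field_simp
  have e2 : qPoch (q ^ n)⁻¹ q (m + 1) =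
      qPoch N⁻¹ q m * (1 - N⁻¹ * M) * (1 - N⁻¹ * q * M) / (1 - N⁻¹) := by
    have hNq : (q ^ n)⁻¹ = N⁻¹ * q := by
      rw [hN, pow_succ]
      field_simp
    have : 1 - N⁻¹ ≠ 0 := by
      have := (one_lt_inv₀ hN0).2 hN1
      linarith
    rw [eq_div_iff this, hNq, mul_comm, qPoch_shift, qPoch_succ, pow_succ, ← hM]
    ring
  set D := α * β * q * N with hD
  have d1 : α * β * q ^ (n + 1 + 1) = D := by rw [hD, hN]; ring
  have d2 : α * β * q ^ (n + 2 + 1) = D * q := by rw [hD, hN]; ring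
  have d3 : α * β * q ^ (n + 1) * q = D := by rw [hD, hN]; ring
  have d4 : α * β * q ^ (n + 1) = α * β * N := by rw [hN]
  have e3 : qPoch (D * q) q (m + 1) = qPoch D q m * (1 - D * M) * (1 - D * q * M) / (1 - D) := by
    rw [eq_div_iff h1, mul_comm, qPoch_shift, qPoch_succ, pow_succ, ← hM]
    ring
  have e4 : qPoch (α * β * q ^ (n + 1)) q (m + 1) = (1 - α * β * N) * qPoch D q m := by
    rw [qPoch_succ_left, d3, d4]
  unfold ljCoeff
  rw [d1, d2, e1, e2, e3, e4, ← hN]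
  simp only [qPoch_succ, pow_succ q m, ← hM]
  generalize qPoch N⁻¹ q m = c
  generalize qPoch D q m = e
  generalize qPoch (α * q) q m = f at *
  generalize qPoch q q m = g at *
  have key := recurrence_identity (α := α) (β := β) (M := M) hq0.ne' hN0.ne' hNi' h1 h2 h3 h4
  rw [← hD] at key
  clear_value D M
  generalize 1 - α * β * q * N ^ 2 = S3 at *
  generalize 1 - α * β * q ^ 2 * N ^ 2 = S4 at *
  generalize 1 - α * β * N ^ 2 = S2 at *
  generalize 1 - α * q * M = F at *
  generalize 1 - q * M = G at *
  -- The term of index `m` receives the denominators of index `m + 1`.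
  have hT : c * e / f * (M / g) = c * e * M / (f * g * F * G) * (F * G) := by
    field_simp
  rw [hT]
  generalize 1 - D = S1 at *
  generalize 1 - N⁻¹ = S0 at *
  generalize 1 - N⁻¹ * M = S5 at *
  linear_combination (c * e * M / (f * g * F * G)) * key

/-! ### Three-term recurrence, and values at `0` and `1`. -/

/-- Two powers of `q` are absorbed into `(α * q) * (β * q) < 1`. With only one power the bound can
fail, hence the separate treatment of `n = 0` in `ljRatio` and the extra assumption of the theorem
for `n = 1`. -/
theorem one_sub_mul_pow_pos {q α β : ℝ} (hq0 : 0 < q) (hq1 : q < 1) (hα0 : 0 < α * q)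
    (hα1 : α * q < 1) (hβ0 : 0 < β * q) (hβ1 : β * q < 1) {m : ℕ} (hm : 2 ≤ m) :
    0 < 1 - α * β * q ^ m := by
  obtain ⟨k, rfl⟩ := Nat.exists_eq_add_of_le hm
  have h1 : α * q * (β * q) < 1 := by nlinarith
  have h2 : q ^ k ≤ 1 := pow_le_one₀ hq0.le hq1.le
  have h3 : 0 < α * q * (β * q) := mul_pos hα0 hβ0
  have : α * β * q ^ (2 + k) = α * q * (β * q) * q ^ k := by ring
  rw [this]
  nlinarith

/-- The factor `(1 - αβq^(n+1)) / (1 - αβq^(2n+1))`, continued by `1` to `n = 0`. -/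
noncomputable def ljRatio (q α β : ℝ) (n : ℕ) : ℝ :=
  if n = 0 then 1 else (1 - α * β * q ^ (n + 1)) / (1 - α * β * q ^ (2 * n + 1))

/-- The coefficient `A n` of the three-term recurrence. -/
noncomputable def ljA (q α β : ℝ) (n : ℕ) : ℝ :=
  q ^ n * (1 - α * q ^ (n + 1)) * ljRatio q α β n / (1 - α * β * q ^ (2 * n + 2))

/-- The coefficient `C n` of the three-term recurrence. -/
noncomputable def ljC (q α β : ℝ) (n : ℕ) : ℝ :=
  α * q ^ n * (1 - q ^ n) * (1 - β * q ^ n) /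
    ((1 - α * β * q ^ (2 * n)) * (1 - α * β * q ^ (2 * n + 1)))

/-- The quotient of consecutive values at `1`. -/
noncomputable def ljOne (q α β : ℝ) (n : ℕ) : ℝ :=
  α * q ^ (2 * n + 1) * (1 - β * q ^ (n + 1)) * ljRatio q α β n / (1 - α * β * q ^ (2 * n + 2))

section
variable {q α β : ℝ}

theorem one_sub_mul_pow_succ_pos (hq0 : 0 < q) (hq1 : q < 1) (hα0 : 0 < α * q) (hα1 : α * q < 1)
    (n : ℕ) : 0 < 1 - α * q ^ (n + 1) := by
  have h2 : q ^ n ≤ 1 := pow_le_one₀ hq0.le hq1.le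
  have : α * q ^ (n + 1) = α * q * q ^ n := by ring
  rw [this]
  nlinarith

theorem ljRatio_pos (hq0 : 0 < q) (hq1 : q < 1) (hα0 : 0 < α * q) (hα1 : α * q < 1)
    (hβ0 : 0 < β * q) (hβ1 : β * q < 1) (n : ℕ) : 0 < ljRatio q α β n := by
  unfold ljRatio
  split_ifs with h
  · exact one_pos
  · exact div_pos (one_sub_mul_pow_pos hq0 hq1 hα0 hα1 hβ0 hβ1 (by omega))
      (one_sub_mul_pow_pos hq0 hq1 hα0 hα1 hβ0 hβ1 (by omega))

theorem ljA_pos (hq0 : 0 < q) (hq1 : q < 1) (hα0 : 0 < α * q) (hα1 : α * q < 1)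
    (hβ0 : 0 < β * q) (hβ1 : β * q < 1) (n : ℕ) : 0 < ljA q α β n :=
  div_pos (mul_pos (mul_pos (pow_pos hq0 n) (one_sub_mul_pow_succ_pos hq0 hq1 hα0 hα1 n))
    (ljRatio_pos hq0 hq1 hα0 hα1 hβ0 hβ1 n))
    (one_sub_mul_pow_pos hq0 hq1 hα0 hα1 hβ0 hβ1 (by omega))

theorem ljOne_pos (hq0 : 0 < q) (hq1 : q < 1) (hα0 : 0 < α * q) (hα1 : α * q < 1)
    (hβ0 : 0 < β * q) (hβ1 : β * q < 1) (n : ℕ) : 0 < ljOne q α β n :=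
  div_pos (mul_pos (mul_pos (mul_pos (pos_of_mul_pos_left hα0 hq0.le) (pow_pos hq0 _))
    (one_sub_mul_pow_succ_pos hq0 hq1 hβ0 hβ1 n))
    (ljRatio_pos hq0 hq1 hα0 hα1 hβ0 hβ1 n))
    (one_sub_mul_pow_pos hq0 hq1 hα0 hα1 hβ0 hβ1 (by omega))

theorem ljC_pos (hq0 : 0 < q) (hq1 : q < 1) (hα0 : 0 < α * q) (hα1 : α * q < 1)
    (hβ0 : 0 < β * q) (hβ1 : β * q < 1) (n : ℕ) : 0 < ljC q α β (n + 1) :=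
  div_pos (mul_pos (mul_pos (mul_pos (pos_of_mul_pos_left hα0 hq0.le) (pow_pos hq0 _))
    (sub_pos.2 (pow_lt_one₀ hq0.le hq1 n.succ_ne_zero)))
    (one_sub_mul_pow_succ_pos hq0 hq1 hβ0 hβ1 n))
    (mul_pos (one_sub_mul_pow_pos hq0 hq1 hα0 hα1 hβ0 hβ1 (by omega))
      (one_sub_mul_pow_pos hq0 hq1 hα0 hα1 hβ0 hβ1 (by omega)))

theorem ljConst_zero : ljConst q α β 0 = 1 := by simp [ljConst, qPoch_zero]

/-- In the quotient of the two denominators the symbols telescope, leaving three linear factors, one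
of which is `1 - D`. For `n = 0` that factor would be `1 - α * β * q`, possibly zero, so this case
is computed directly. -/
theorem ljConst_succ (hq0 : 0 < q) (hq1 : q < 1) (hα0 : 0 < α * q) (hα1 : α * q < 1)
    (hβ0 : 0 < β * q) (hβ1 : β * q < 1) (n : ℕ) :
    ljConst q α β (n + 1) = -ljA q α β n * ljConst q α β n := by
  have hpos : ∀ m, 2 ≤ m → 0 < 1 - α * β * q ^ m := fun m hm =>
    one_sub_mul_pow_pos hq0 hq1 hα0 hα1 hβ0 hβ1 hm
  rcases n with _ | n
  · simp only [ljConst, ljA, ljRatio, qPoch, zero_add, Finset.prod_range_one,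
      Finset.prod_range_zero, if_true]
    simp
    ring
  · set D := α * β * q * q ^ (n + 1) with hD
    have h1 : (1 - D) * qPoch (D * q) q (n + 2) = qPoch D q (n + 1) *
        (1 - α * β * q ^ (2 * (n + 1) + 1)) * (1 - α * β * q ^ (2 * (n + 1) + 2)) := by
      rw [qPoch_shift, qPoch_succ, hD]
      ring
    have hDp : 0 < 1 - D := by
      have := hpos (n + 2) (by omega)
      rw [hD]
      convert this using 2
      ring
    have hDq0 : 0 < D * q := by
      have := mul_pos hα0 hβ0
      have h3 : D * q = α * q * (β * q) * q ^ (n + 1) := by rw [hD]; ring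
      rw [h3]
      positivity
    have hD1 : D < 1 := by linarith
    have hD0 : 0 < D := pos_of_mul_pos_left hDq0 hq0.le
    have hP := qPoch_pos hq0 hq1 hD0 hD1 (n + 1)
    have hQ := qPoch_pos hq0 hq1 hDq0 (by nlinarith) (n + 2)
    have e1 : α * β * q * q ^ (n + 1 + 1) = D * q := by rw [hD]; ring
    have e2 : α * β * q ^ (n + 1 + 1) = D := by rw [hD]; ring
    have hc : (n + 1 + 1).choose 2 = (n + 1) + (n + 1).choose 2 := by
      rw [Nat.choose_succ_succ' (n + 1) 1, Nat.choose_one_right]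
    have a1 := hpos (2 * (n + 1) + 1) (by omega)
    have a2 := hpos (2 * (n + 1) + 2) (by omega)
    unfold ljConst ljA ljRatio
    rw [if_neg n.succ_ne_zero, e1, e2, ← hD, hc, qPoch_succ (α * q) q (n + 1), pow_add]
    have e3 : α * q ^ (n + 1 + 1) = α * q * q ^ (n + 1) := by ring
    rw [e3]
    generalize 1 - α * β * q ^ (2 * (n + 1) + 1) = S at *
    generalize 1 - α * β * q ^ (2 * (n + 1) + 2) = S' at *
    generalize 1 - D = S'' at *
    generalize qPoch D q (n + 1) = P at *
    rw [show qPoch (D * q) q (n + 2) = P * S * S' / S'' from by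
      rw [eq_div_iff hDp.ne', mul_comm, h1]]
    field_simp
    ring

/-- The three-term recurrence. -/
theorem littleQJacobi_recurrence (hq0 : 0 < q) (hq1 : q < 1) (hα0 : 0 < α * q)
    (hα1 : α * q < 1) (hβ0 : 0 < β * q) (hβ1 : β * q < 1) (n : ℕ) :
    littleQJacobi q α β (n + 2) =
      (X - C (ljA q α β (n + 1) + ljC q α β (n + 1))) * littleQJacobi q α β (n + 1) -
        C (ljA q α β n * ljC q α β (n + 1)) * littleQJacobi q α β n := by
  have hpos : ∀ m, 2 ≤ m → 1 - α * β * q ^ m ≠ 0 := fun m hm =>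
    (one_sub_mul_pow_pos hq0 hq1 hα0 hα1 hβ0 hβ1 hm).ne'
  have k1 := ljConst_succ hq0 hq1 hα0 hα1 hβ0 hβ1 n
  have k2 := ljConst_succ hq0 hq1 hα0 hα1 hβ0 hβ1 (n + 1)
  ext m
  rw [coeff_sub, sub_mul, coeff_sub, coeff_C_mul, coeff_C_mul]
  rcases m with _ | m
  · simp only [coeff_X_mul_zero, littleQJacobi_coeff hq0.ne', ljCoeff_zero]
    linear_combination k2 + ljC q α β (n + 1) * k1
  · have e1 : α * β * q * q ^ (n + 1) = α * β * q ^ (n + 2) := by ring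
    have e2 : α * β * (q ^ (n + 1)) ^ 2 = α * β * q ^ (2 * (n + 1)) := by ring
    have e3 : α * β * q * (q ^ (n + 1)) ^ 2 = α * β * q ^ (2 * (n + 1) + 1) := by ring
    have e4 : α * β * q ^ 2 * (q ^ (n + 1)) ^ 2 = α * β * q ^ (2 * (n + 1) + 2) := by ring
    have e5 : α * q * q ^ (n + 1) = α * q ^ (n + 2) := by ring
    have key := ljCoeff_recurrence (β := β) hq0 hq1 hα0 hα1 (n := n) rfl
      (e1 ▸ hpos _ (by omega)) (e2 ▸ hpos _ (by omega)) (e3 ▸ hpos _ (by omega))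
      (e4 ▸ hpos _ (by omega)) m
    rw [e1, e2, e3, e4, e5] at key
    have hA : q ^ (n + 1) * (1 - α * q ^ (n + 2)) * (1 - α * β * q ^ (n + 2)) /
        ((1 - α * β * q ^ (2 * (n + 1) + 1)) * (1 - α * β * q ^ (2 * (n + 1) + 2))) =
        ljA q α β (n + 1) := by
      rw [ljA, ljRatio, if_neg n.succ_ne_zero, mul_div_assoc', div_div]
    rw [hA, ← ljC] at key
    simp only [coeff_X_mul, littleQJacobi_coeff hq0.ne']
    -- `k1` and `k2` express all three constant terms through that of degree `n + 1`, which then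
    -- multiplies `key`.
    linear_combination (ljCoeff q α β (n + 2) (m + 1)) * k2 + ljConst q α β (n + 1) * key +
      ljC q α β (n + 1) * ljCoeff q α β n (m + 1) * k1

theorem littleQJacobi_one (hq0 : 0 < q) (hq1 : q < 1) (hα0 : 0 < α * q)
    (hα1 : α * q < 1) (hβ0 : 0 < β * q) (hβ1 : β * q < 1) :
    littleQJacobi q α β 1 = X - C (ljA q α β 0) := by
  have h2 := one_sub_mul_pow_pos hq0 hq1 hα0 hα1 hβ0 hβ1 le_rfl
  have k1 := ljConst_succ hq0 hq1 hα0 hα1 hβ0 hβ1 0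
  rw [ljConst_zero, mul_one, zero_add] at k1
  ext m
  rw [littleQJacobi_coeff hq0.ne', k1]
  rcases m with _ | _ | m
  · simp [ljCoeff_zero]
  · have h3 : 1 - α * q ≠ 0 := by linarith
    have h4 : 1 - q ≠ 0 := by linarith
    simp only [ljCoeff, ljA, ljRatio, qPoch, zero_add, Finset.prod_range_one, coeff_sub, coeff_X,
      coeff_C, if_true, pow_one, pow_zero, mul_one, mul_zero, one_mul]
    rw [one_add_one_eq_two, if_neg one_ne_zero]
    generalize 1 - α * β * q ^ 2 = S at *
    field_simp
    ring
  · rw [ljCoeff, qPoch_inv_pow_eq_zero hq0.ne' (by omega)]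
    simp [coeff_X]

theorem littleQJacobi_monic_natDegree (hq0 : 0 < q) (hq1 : q < 1) (hα0 : 0 < α * q)
    (hα1 : α * q < 1) (hβ0 : 0 < β * q) (hβ1 : β * q < 1) (n : ℕ) :
    (littleQJacobi q α β n).Monic ∧ (littleQJacobi q α β n).natDegree = n := by
  induction n using Nat.strong_induction_on with
  | _ n ih =>
    rcases n with _ | _ | n
    · simp [littleQJacobi_zero]
    · rw [zero_add, littleQJacobi_one hq0 hq1 hα0 hα1 hβ0 hβ1]
      exact ⟨monic_X_sub_C _, natDegree_X_sub_C _⟩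
    · obtain ⟨m1, d1⟩ := ih (n + 1) (by omega)
      obtain ⟨m0, d0⟩ := ih n (by omega)
      have hm := (monic_X_sub_C (ljA q α β (n + 1) + ljC q α β (n + 1))).mul m1
      have hd : ((X - C (ljA q α β (n + 1) + ljC q α β (n + 1))) *
          littleQJacobi q α β (n + 1)).natDegree = n + 2 := by
        rw [(monic_X_sub_C _).natDegree_mul m1, natDegree_X_sub_C, d1]
        omega
      have hl : (C (ljA q α β n * ljC q α β (n + 1)) * littleQJacobi q α β n).natDegree <
          n + 2 := by
        refine (natDegree_C_mul_le _ _).trans_lt ?_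
        omega
      rw [littleQJacobi_recurrence hq0 hq1 hα0 hα1 hβ0 hβ1]
      refine ⟨hm.sub_of_left (degree_lt_degree (by rwa [hd])), ?_⟩
      rw [natDegree_sub_eq_left_of_natDegree_lt (by rwa [hd]), hd]

theorem littleQJacobi_eval_zero_succ (hq0 : 0 < q) (hq1 : q < 1) (hα0 : 0 < α * q)
    (hα1 : α * q < 1) (hβ0 : 0 < β * q) (hβ1 : β * q < 1) (n : ℕ) :
    (littleQJacobi q α β (n + 1)).eval 0 = -ljA q α β n * (littleQJacobi q α β n).eval 0 := by
  rw [← coeff_zero_eq_eval_zero, ← coeff_zero_eq_eval_zero, littleQJacobi_coeff hq0.ne',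
    littleQJacobi_coeff hq0.ne', ljCoeff_zero, ljCoeff_zero, mul_one, mul_one,
    ljConst_succ hq0 hq1 hα0 hα1 hβ0 hβ1]

/-- At `1` no single coefficient gives the value, so the ratio is propagated through the recurrence.
-/
theorem littleQJacobi_eval_one_succ (hq0 : 0 < q) (hq1 : q < 1) (hα0 : 0 < α * q)
    (hα1 : α * q < 1) (hβ0 : 0 < β * q) (hβ1 : β * q < 1) (n : ℕ) :
    (littleQJacobi q α β (n + 1)).eval 1 = ljOne q α β n * (littleQJacobi q α β n).eval 1 := by
  have hpos : ∀ m, 2 ≤ m → 1 - α * β * q ^ m ≠ 0 := fun m hm =>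
    (one_sub_mul_pow_pos hq0 hq1 hα0 hα1 hβ0 hβ1 hm).ne'
  induction n with
  | zero =>
    rw [zero_add, littleQJacobi_one hq0 hq1 hα0 hα1 hβ0 hβ1, littleQJacobi_zero]
    have := hpos 2 le_rfl
    simp only [ljA, ljOne, ljRatio, eval_sub, eval_X, eval_C, eval_one, if_true, mul_zero, zero_add,
      pow_zero, pow_one]
    obtain ⟨S, hS⟩ : ∃ s, s = 1 - α * β * q ^ 2 := ⟨_, rfl⟩
    rw [← hS] at this ⊢
    field_simp
    rw [hS]
    ring
  | succ n ih =>
    rw [littleQJacobi_recurrence hq0 hq1 hα0 hα1 hβ0 hβ1, eval_sub, eval_mul, eval_mul, ih]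
    simp only [eval_sub, eval_X, eval_C]
    have key : (1 - (ljA q α β (n + 1) + ljC q α β (n + 1))) * ljOne q α β n -
        ljA q α β n * ljC q α β (n + 1) = ljOne q α β (n + 1) * ljOne q α β n := by
      have h0 := hpos (n + 1 + 1) (by omega)
      have h1 := hpos (2 * (n + 1)) (by omega)
      have h2 := hpos (2 * (n + 1) + 1) (by omega)
      have h3 := hpos (2 * (n + 1) + 2) (by omega)
      simp only [ljA, ljOne, ljC]
      -- Every term of the expanded identity contains this factor exactly once, so its value is
      -- irrelevant and `n = 0` needs no separate case.
      generalize ljRatio q α β n = t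
      simp only [ljRatio, if_neg n.succ_ne_zero]
      rw [show 2 * n + 2 = 2 * (n + 1) by ring]
      obtain ⟨N, hN⟩ : ∃ N, N = q ^ (n + 1) := ⟨_, rfl⟩
      have hq := hq0.ne'
      have e1 : q ^ (2 * (n + 1)) = N ^ 2 := by rw [hN]; ring
      have e2 : q ^ (2 * (n + 1) + 1) = N ^ 2 * q := by rw [hN]; ring
      have e3 : q ^ (2 * (n + 1) + 2) = N ^ 2 * q ^ 2 := by rw [hN]; ring
      have e4 : q ^ (n + 1 + 1) = N * q := by rw [hN]; ring
      have e5 : q ^ (2 * n + 1) = N ^ 2 / q := by rw [hN]; field_simp; ring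
      have e6 : q ^ n = N / q := by rw [hN]; field_simp; ring
      rw [e1, e2, e3, e4, e5, e6, ← hN]
      rw [e1] at h1
      rw [e2] at h2
      rw [e3] at h3
      obtain ⟨S2, f2⟩ : ∃ s, s = 1 - α * β * N ^ 2 := ⟨_, rfl⟩
      obtain ⟨S3, f3⟩ : ∃ s, s = 1 - α * β * (N ^ 2 * q) := ⟨_, rfl⟩
      obtain ⟨S4, f4⟩ : ∃ s, s = 1 - α * β * (N ^ 2 * q ^ 2) := ⟨_, rfl⟩
      rw [← f2] at h1
      rw [← f3] at h2
      rw [← f4] at h3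
      rw [← f2, ← f3, ← f4]
      field_simp
      subst f2 f3 f4
      ring
    linear_combination (littleQJacobi q α β n).eval 1 * key

end

/-! ### Contiguous relations for `α / q` and `β / q`. -/

section
variable {q α β : ℝ}

/-- Both parameter changes replace `α * β` by `α * β / q`; this compares the denominators of the
constant terms before and after. -/
theorem ljConst_shift (hq0 : 0 < q) (hq1 : q < 1) (hα0 : 0 < α * q)
    (hβ0 : 0 < β * q) (n : ℕ) (hn : α * β * q ^ (n + 1) < 1) :
    qPoch (α * β * q ^ (n + 1)) q (n + 1) * (1 - α * β * q ^ (2 * (n + 1))) =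
        (1 - α * β * q ^ (n + 1)) * qPoch (α * β * q * q ^ (n + 1)) q (n + 1) ∧
      0 < qPoch (α * β * q ^ (n + 1)) q (n + 1) ∧
      0 < qPoch (α * β * q * q ^ (n + 1)) q (n + 1) := by
  have hα := pos_of_mul_pos_left hα0 hq0.le
  have hβ := pos_of_mul_pos_left hβ0 hq0.le
  have e : α * β * q * q ^ (n + 1) = α * β * q ^ (n + 1) * q := by ring
  rw [e]
  refine ⟨?_, qPoch_pos hq0 hq1 (by positivity) hn _, qPoch_pos hq0 hq1 (by positivity) ?_ _⟩
  · rw [qPoch_shift]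
    ring
  · exact mul_lt_one_of_nonneg_of_lt_one_left (by positivity) hn hq1.le

/-- Together with `ljCoeff_shift`, this brings all coefficients in the contiguous relations to the
same symbols, so that a rational identity in `q ^ (n + 1)` and `q ^ m` remains. -/
theorem ljCoeff_pred (hq0 : 0 < q) (hq1 : q < 1) (n m : ℕ) :
    ljCoeff q α β n m = qPoch (q ^ (n + 1))⁻¹ q m * (1 - (q ^ (n + 1))⁻¹ * q ^ m) /
      (1 - (q ^ (n + 1))⁻¹) * qPoch (α * β * q ^ (n + 1)) q m / qPoch (α * q) q m *
        (q ^ m / qPoch q q m) := by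
  have h : 1 - (q ^ (n + 1))⁻¹ ≠ 0 := by
    have := (one_lt_inv₀ (pow_pos hq0 (n + 1))).2 (pow_lt_one₀ hq0.le hq1 n.succ_ne_zero)
    linarith
  have hNq : (q ^ n)⁻¹ = (q ^ (n + 1))⁻¹ * q := by
    rw [pow_succ]
    field_simp
  rw [ljCoeff, ← qPoch_shift, hNq, mul_div_cancel_left₀ _ h]

theorem ljCoeff_shift (n m : ℕ) (hn : 1 - α * β * q ^ (n + 1) ≠ 0) :
    ljCoeff q α β (n + 1) m = qPoch (q ^ (n + 1))⁻¹ q m *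
      (qPoch (α * β * q ^ (n + 1)) q m * (1 - α * β * q ^ (n + 1) * q ^ m) /
        (1 - α * β * q ^ (n + 1))) / qPoch (α * q) q m * (q ^ m / qPoch q q m) := by
  rw [ljCoeff, ← qPoch_shift, mul_div_cancel_left₀ _ hn]
  ring_nf

/-- The factor relating the values at `0` for the parameters `α / q` and `α`. -/
noncomputable def ljKappa (q α β : ℝ) (n : ℕ) : ℝ :=
  (1 - α) * (1 - α * β * (q ^ n) ^ 2) / ((1 - α * q ^ n) * (1 - α * β * q ^ n))

/-- The factor relating the values at `0` for the parameters `β / q` and `β`. -/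
noncomputable def ljMu (q α β : ℝ) (n : ℕ) : ℝ :=
  (1 - α * β * (q ^ n) ^ 2) / (1 - α * β * q ^ n)

/-- The multiplier of `littleQJacobi q α β n` is forced by the constant terms: the new one is
`ljKappa` times the old one, and consecutive ones have ratio `-ljA`. The case `α = 1` is excluded
because `1 - α` becomes a denominator of the coefficients. -/
theorem littleQJacobi_div_left (hq0 : 0 < q) (hq1 : q < 1) (hα0 : 0 < α * q) (hα1 : α * q < 1)
    (hβ0 : 0 < β * q) (hβ1 : β * q < 1) (n : ℕ) (hn : α * β * q ^ (n + 1) < 1) (hα : α ≠ 1) :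
    littleQJacobi q (α / q) β (n + 1) = littleQJacobi q α β (n + 1) +
      C ((1 - ljKappa q α β (n + 1)) * ljA q α β n) * littleQJacobi q α β n := by
  have hα' : 1 - α ≠ 0 := sub_ne_zero.2 hα.symm
  have hE : 1 - α * β * q ^ (n + 1) ≠ 0 := by linarith
  have k1 := ljConst_succ hq0 hq1 hα0 hα1 hβ0 hβ1 n
  obtain ⟨c1, c2, c3⟩ := ljConst_shift hq0 hq1 hα0 hβ0 n hn
  have hαN := one_sub_mul_pow_succ_pos hq0 hq1 hα0 hα1 n
  have hs := qPoch_shift α q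
  have hf := fun m => (qPoch_pos hq0 hq1 hα0 hα1 m).ne'
  have hM : ∀ m, 1 - α * q ^ m ≠ 0 := by
    rintro (_ | m)
    · simpa using hα'
    · exact (one_sub_mul_pow_succ_pos hq0 hq1 hα0 hα1 m).ne'
  have hp : ∀ m, qPoch α q m = (1 - α) * qPoch (α * q) q m / (1 - α * q ^ m) := fun m => by
    rw [eq_div_iff (hM m), hs]
  have k2 : ljConst q (α / q) β (n + 1) = ljKappa q α β (n + 1) * ljConst q α β (n + 1) := by
    have e1 : α / q * q = α := by field_simp
    have e2 : α / q * β * q * q ^ (n + 1) = α * β * q ^ (n + 1) := by field_simp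
    have e3 : q ^ (2 * (n + 1)) = (q ^ (n + 1)) ^ 2 := by ring
    unfold ljConst ljKappa
    rw [e1, e2, hp]
    rw [e3] at c1
    have hQ : qPoch (α * β * q * q ^ (n + 1)) q (n + 1) = qPoch (α * β * q ^ (n + 1)) q (n + 1) *
        (1 - α * β * (q ^ (n + 1)) ^ 2) / (1 - α * β * q ^ (n + 1)) := by
      rw [eq_div_iff hE, c1, mul_comm]
    have hS : 1 - α * β * (q ^ (n + 1)) ^ 2 ≠ 0 := by
      rw [← e3]
      exact (one_sub_mul_pow_pos hq0 hq1 hα0 hα1 hβ0 hβ1 (by omega)).ne'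
    rw [hQ]
    have := c2.ne'
    generalize 1 - α * β * (q ^ (n + 1)) ^ 2 = S at *
    generalize qPoch (α * β * q ^ (n + 1)) q (n + 1) = P at *
    generalize 1 - α * β * q ^ (n + 1) = E at *
    generalize 1 - α * q ^ (n + 1) = F at *
    field_simp
  ext m
  rw [coeff_add, coeff_C_mul]
  simp only [littleQJacobi_coeff hq0.ne']
  have key : ljKappa q α β (n + 1) * ljCoeff q (α / q) β (n + 1) m =
      ljCoeff q α β (n + 1) m - (1 - ljKappa q α β (n + 1)) * ljCoeff q α β n m := by
    have e1 : α / q * q = α := by field_simp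
    have e2 : α / q * β * q ^ (n + 1 + 1) = α * β * q ^ (n + 1) := by
      rw [pow_succ q (n + 1)]
      field_simp
    rw [ljCoeff_shift n m hE, ljCoeff_pred hq0 hq1 n m, ljCoeff, e1, e2, hp, ljKappa]
    have hN1 : q ^ (n + 1) < 1 := pow_lt_one₀ hq0.le hq1 n.succ_ne_zero
    have hN0 : 0 < q ^ (n + 1) := pow_pos hq0 _
    have hM' := hM m
    have hf' := hf m
    have hg := (qPoch_pos hq0 hq1 hq0 hq1 m).ne'
    have hαN' := hαN.ne'
    clear hs hp hM hf c1 c2 c3 k1 k2 hn hαN e1 e2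
    generalize q ^ (n + 1) = N at *
    generalize q ^ m = M at *
    generalize qPoch N⁻¹ q m = c at *
    generalize qPoch (α * β * N) q m = e at *
    generalize qPoch (α * q) q m = f at *
    generalize qPoch q q m = g at *
    have hi : 1 - N⁻¹ = (N - 1) / N := by field_simp
    rw [hi]
    have h3 : N - 1 ≠ 0 := by linarith
    obtain ⟨E, hE'⟩ : ∃ s, s = 1 - α * β * N := ⟨_, rfl⟩
    obtain ⟨F, hF'⟩ : ∃ s, s = 1 - α * N := ⟨_, rfl⟩
    obtain ⟨G, hG'⟩ : ∃ s, s = 1 - α * M := ⟨_, rfl⟩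
    obtain ⟨H, hH'⟩ : ∃ s, s = 1 - α := ⟨_, rfl⟩
    rw [← hE'] at hE ⊢
    rw [← hF'] at hαN' ⊢
    rw [← hG'] at hM' ⊢
    rw [← hH'] at hα' ⊢
    field_simp
    subst hE' hF' hG' hH'
    ring
  linear_combination (ljCoeff q (α / q) β (n + 1) m) * k2 + ljConst q α β (n + 1) * key -
    (1 - ljKappa q α β (n + 1)) * ljCoeff q α β n m * k1

theorem littleQJacobi_div_right (hq0 : 0 < q) (hq1 : q < 1) (hα0 : 0 < α * q) (hα1 : α * q < 1)
    (hβ0 : 0 < β * q) (hβ1 : β * q < 1) (n : ℕ) (hn : α * β * q ^ (n + 1) < 1) :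
    littleQJacobi q α (β / q) (n + 1) = littleQJacobi q α β (n + 1) +
      C ((1 - ljMu q α β (n + 1)) * ljA q α β n) * littleQJacobi q α β n := by
  have hE : 1 - α * β * q ^ (n + 1) ≠ 0 := by linarith
  have k1 := ljConst_succ hq0 hq1 hα0 hα1 hβ0 hβ1 n
  obtain ⟨c1, c2, c3⟩ := ljConst_shift hq0 hq1 hα0 hβ0 n hn
  have k2 : ljConst q α (β / q) (n + 1) = ljMu q α β (n + 1) * ljConst q α β (n + 1) := by
    have e2 : α * (β / q) * q * q ^ (n + 1) = α * β * q ^ (n + 1) := by field_simp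
    have e3 : q ^ (2 * (n + 1)) = (q ^ (n + 1)) ^ 2 := by ring
    unfold ljConst ljMu
    rw [e2]
    rw [e3] at c1
    have hQ : qPoch (α * β * q * q ^ (n + 1)) q (n + 1) = qPoch (α * β * q ^ (n + 1)) q (n + 1) *
        (1 - α * β * (q ^ (n + 1)) ^ 2) / (1 - α * β * q ^ (n + 1)) := by
      rw [eq_div_iff hE, c1, mul_comm]
    have hS : 1 - α * β * (q ^ (n + 1)) ^ 2 ≠ 0 := by
      rw [← e3]
      exact (one_sub_mul_pow_pos hq0 hq1 hα0 hα1 hβ0 hβ1 (by omega)).ne'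
    rw [hQ]
    have := c2.ne'
    generalize 1 - α * β * (q ^ (n + 1)) ^ 2 = S at *
    generalize qPoch (α * β * q ^ (n + 1)) q (n + 1) = P at *
    generalize 1 - α * β * q ^ (n + 1) = E at *
    field_simp
  ext m
  rw [coeff_add, coeff_C_mul]
  simp only [littleQJacobi_coeff hq0.ne']
  have key : ljMu q α β (n + 1) * ljCoeff q α (β / q) (n + 1) m =
      ljCoeff q α β (n + 1) m - (1 - ljMu q α β (n + 1)) * ljCoeff q α β n m := by
    have e2 : α * (β / q) * q ^ (n + 1 + 1) = α * β * q ^ (n + 1) := by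
      rw [pow_succ q (n + 1)]
      field_simp
    rw [ljCoeff_shift n m hE, ljCoeff_pred hq0 hq1 n m, ljCoeff, e2, ljMu]
    have hN1 : q ^ (n + 1) < 1 := pow_lt_one₀ hq0.le hq1 n.succ_ne_zero
    have hN0 : 0 < q ^ (n + 1) := pow_pos hq0 _
    have hf := (qPoch_pos hq0 hq1 hα0 hα1 m).ne'
    have hg := (qPoch_pos hq0 hq1 hq0 hq1 m).ne'
    clear c1 c2 c3 k1 k2 hn e2
    generalize q ^ (n + 1) = N at *
    generalize q ^ m = M at *
    generalize qPoch N⁻¹ q m = c at *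
    generalize qPoch (α * β * N) q m = e at *
    generalize qPoch (α * q) q m = f at *
    generalize qPoch q q m = g at *
    have hi : 1 - N⁻¹ = (N - 1) / N := by field_simp
    rw [hi]
    have h3 : N - 1 ≠ 0 := by linarith
    obtain ⟨E, hE'⟩ : ∃ s, s = 1 - α * β * N := ⟨_, rfl⟩
    rw [← hE'] at hE ⊢
    field_simp
    subst hE'
    ring
  linear_combination (ljCoeff q α (β / q) (n + 1) m) * k2 + ljConst q α β (n + 1) * key -
    (1 - ljMu q α β (n + 1)) * ljCoeff q α β n m * k1

theorem ljKappa_neg (hq0 : 0 < q) (hq1 : q < 1) (hα0 : 0 < α * q) (hα1 : α * q < 1)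
    (hβ0 : 0 < β * q) (hβ1 : β * q < 1) (n : ℕ) (hn : α * β * q ^ (n + 1) < 1) (hα : 1 < α) :
    ljKappa q α β (n + 1) < 0 := by
  have h := one_sub_mul_pow_pos hq0 hq1 hα0 hα1 hβ0 hβ1 (m := (n + 1) * 2) (by omega)
  rw [pow_mul] at h
  exact div_neg_of_neg_of_pos (mul_neg_of_neg_of_pos (by linarith) h)
    (mul_pos (one_sub_mul_pow_succ_pos hq0 hq1 hα0 hα1 n) (by linarith))

theorem one_sub_ljMu (n : ℕ) (hn : α * β * q ^ (n + 1) < 1) :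
    1 - ljMu q α β (n + 1) =
      -(α * β * q ^ (n + 1) * (1 - q ^ (n + 1)) / (1 - α * β * q ^ (n + 1))) := by
  have hE : 1 - α * β * q ^ (n + 1) ≠ 0 := by linarith
  rw [ljMu]
  generalize q ^ (n + 1) = N at *
  obtain ⟨E, hE'⟩ : ∃ s, s = 1 - α * β * N := ⟨_, rfl⟩
  rw [← hE'] at hE ⊢
  field_simp
  rw [hE']
  ring

theorem one_sub_ljMu_neg (hq0 : 0 < q) (hq1 : q < 1) (hα0 : 0 < α * q)
    (hβ0 : 0 < β * q) (n : ℕ) (hn : α * β * q ^ (n + 1) < 1) :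
    1 - ljMu q α β (n + 1) < 0 := by
  have hα := pos_of_mul_pos_left hα0 hq0.le
  have hβ := pos_of_mul_pos_left hβ0 hq0.le
  have hN1 : 0 < 1 - q ^ (n + 1) := sub_pos.2 (pow_lt_one₀ hq0.le hq1 n.succ_ne_zero)
  have hE : 0 < 1 - α * β * q ^ (n + 1) := by linarith
  rw [one_sub_ljMu n hn, neg_lt_zero]
  positivity

/-- The left side is the ratio of the shifted polynomial at `1` to the polynomial of degree `n` at
`1`. It simplifies to a negative multiple of `β - 1`. -/
theorem ljOne_add_neg (hq0 : 0 < q) (hq1 : q < 1) (hα0 : 0 < α * q) (hα1 : α * q < 1)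
    (hβ0 : 0 < β * q) (hβ1 : β * q < 1) (n : ℕ) (hn : α * β * q ^ (n + 1) < 1) (hβ : 1 < β) :
    ljOne q α β n + (1 - ljMu q α β (n + 1)) * ljA q α β n < 0 := by
  have hα := pos_of_mul_pos_left hα0 hq0.le
  have hρ := ljRatio_pos hq0 hq1 hα0 hα1 hβ0 hβ1 n
  have h2 := one_sub_mul_pow_pos hq0 hq1 hα0 hα1 hβ0 hβ1 (m := 2 * n + 2) (by omega)
  have hE : 0 < 1 - α * β * q ^ (n + 1) := by linarith
  have : ljOne q α β n + (1 - ljMu q α β (n + 1)) * ljA q α β n =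
      -(α * q ^ (n + 1) * q ^ n * ljRatio q α β n * (β - 1) / (1 - α * β * q ^ (n + 1))) := by
    rw [one_sub_ljMu n hn, ljOne, ljA]
    have e1 : q ^ (2 * n + 1) = q ^ (n + 1) * q ^ n := by ring
    have e2 : q ^ (2 * n + 2) = (q ^ (n + 1)) ^ 2 := by ring
    rw [e2] at h2
    rw [e1, e2]
    generalize q ^ (n + 1) = N at *
    generalize q ^ n = N' at *
    generalize ljRatio q α β n = ρ at *
    have h2' := h2.ne'
    have hE' := hE.ne'
    obtain ⟨E, e3⟩ : ∃ s, s = 1 - α * β * N := ⟨_, rfl⟩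
    obtain ⟨F, e4⟩ : ∃ s, s = 1 - α * β * N ^ 2 := ⟨_, rfl⟩
    rw [← e3] at hE' ⊢
    rw [← e4] at h2' ⊢
    field_simp
    subst e3 e4
    ring
  rw [this, neg_lt_zero]
  have : 0 < β - 1 := by linarith
  positivity

end

/-! ### Locating zeros of monic real polynomials by signs. -/

namespace AreOrderedZeros
variable {p : ℝ[X]} {n : ℕ} {x : ℕ → ℝ}

theorem eval_eq_zero (h : AreOrderedZeros p n x) {j : ℕ} (hj : j ∈ Set.Icc 1 n) :
    p.eval (x j) = 0 := by
  have := (h.zero_iff (x j)).2 ⟨j, hj, rfl⟩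
  rw [← Complex.coe_algebraMap, aeval_algebraMap_apply, Complex.coe_algebraMap,
    Complex.ofReal_eq_zero] at this
  simpa using this

end AreOrderedZeros

/-- Distinct linear factors are coprime, so their product divides `p`, and the degrees agree. -/
theorem Polynomial.Monic.eq_prod_X_sub_C_of_strictMonoOn {p : ℝ[X]} {n : ℕ} {x : ℕ → ℝ}
    (hp : p.Monic) (hn : p.natDegree = n) (hx : StrictMonoOn x (Set.Icc 1 n))
    (h0 : ∀ j ∈ Set.Icc 1 n, p.eval (x j) = 0) :
    p = ∏ j ∈ Finset.Icc 1 n, (X - C (x j)) := by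
  refine eq_of_monic_of_dvd_of_natDegree_le (monic_prod_X_sub_C _ _) hp ?_ ?_
  · refine Finset.prod_dvd_of_coprime ?_ fun i hi => ?_
    · intro i hi j hj hij
      refine isCoprime_X_sub_C_of_isUnit_sub (sub_ne_zero.2 fun h => hij ?_).isUnit
      exact hx.injOn (by simpa using hi) (by simpa using hj) h
    · exact dvd_iff_isRoot.2 (h0 i (by simpa using hi))
  · rw [natDegree_finsetProd_X_sub_C_eq_card, hn, Nat.card_Icc]
    omega

theorem Polynomial.Monic.areOrderedZeros {p : ℝ[X]} {n : ℕ} {x : ℕ → ℝ}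
    (hp : p.Monic) (hn : p.natDegree = n) (hx : StrictMonoOn x (Set.Icc 1 n))
    (h0 : ∀ j ∈ Set.Icc 1 n, p.eval (x j) = 0) : AreOrderedZeros p n x where
  natDegree_eq := hn
  strictMonoOn := hx
  zero_iff t := by
    rw [hp.eq_prod_X_sub_C_of_strictMonoOn hn hx h0, map_prod, Finset.prod_eq_zero_iff]
    simp [sub_eq_zero]

/-- The `n - j` factors with zeros to the right of `t` are negative and each absorbs one `-1`. The
guards on `hl` and `hr` let `j = 0` and `j = n` cover the unbounded intervals. -/
theorem AreOrderedZeros.sign_pos {p : ℝ[X]} {n : ℕ} {x : ℕ → ℝ} (h : AreOrderedZeros p n x)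
    (hp : p.Monic) {j : ℕ} (hj : j ≤ n) {t : ℝ} (hl : 1 ≤ j → x j < t)
    (hr : j < n → t < x (j + 1)) : 0 < (-1) ^ (n - j) * p.eval t := by
  have hmono := h.strictMonoOn.monotoneOn
  rw [hp.eq_prod_X_sub_C_of_strictMonoOn h.natDegree_eq h.strictMonoOn
    fun j hj => h.eval_eq_zero hj, eval_prod,
    ← Finset.prod_filter_mul_prod_filter_not _ (fun i => i ≤ j)]
  have hc : (Finset.filter (fun i => ¬i ≤ j) (Finset.Icc 1 n)).card = n - j := by
    rw [← Nat.card_Ioc]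
    congr 1
    ext i
    simp only [Finset.mem_filter, Finset.mem_Icc, Finset.mem_Ioc]
    omega
  rw [← hc, ← Finset.prod_const, mul_left_comm, ← Finset.prod_mul_distrib]
  refine mul_pos (Finset.prod_pos fun i hi => ?_) (Finset.prod_pos fun i hi => ?_)
  · simp only [Finset.mem_filter, Finset.mem_Icc] at hi
    have := hmono (a := i) (b := j) ⟨hi.1.1, hi.1.2⟩ ⟨by omega, hj⟩ hi.2
    have := hl (by omega)
    simp only [eval_sub, eval_X, eval_C]
    linarith
  · simp only [Finset.mem_filter, Finset.mem_Icc] at hi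
    have := hmono (a := j + 1) (b := i) ⟨by omega, by omega⟩ ⟨hi.1.1, hi.1.2⟩ (by omega)
    have := hr (by omega)
    simp only [eval_sub, eval_X, eval_C]
    linarith

theorem Polynomial.exists_eval_eq_zero_mem_Ioo (p : ℝ[X]) (s : ℝ) {a b : ℝ} (hab : a < b)
    (ha : s * p.eval a < 0) (hb : 0 < s * p.eval b) : ∃ t ∈ Set.Ioo a b, p.eval t = 0 := by
  obtain ⟨t, ht, h0⟩ := intermediate_value_Ioo hab.le (f := fun t => s * p.eval t)
    (continuous_const.mul p.continuous).continuousOn ⟨ha, hb⟩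
  refine ⟨t, ht, (mul_eq_zero.1 h0).resolve_left ?_⟩
  rintro rfl
  simp at ha

/-- A monic polynomial of degree `n` that changes sign on each of `n` successive intervals has one
zero in each of them and no others. -/
theorem Polynomial.Monic.exists_areOrderedZeros {p : ℝ[X]} {n : ℕ} (hp : p.Monic)
    (hn : p.natDegree = n) (l u : ℕ → ℝ) (hlu : ∀ j ∈ Set.Icc 1 n, l j < u j)
    (hul : ∀ j, 1 ≤ j → j < n → u j ≤ l (j + 1))
    (hl : ∀ j ∈ Set.Icc 1 n, (-1) ^ (n - j) * p.eval (l j) < 0)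
    (hu : ∀ j ∈ Set.Icc 1 n, 0 < (-1) ^ (n - j) * p.eval (u j)) :
    ∃ x, AreOrderedZeros p n x ∧ ∀ j ∈ Set.Icc 1 n, l j < x j ∧ x j < u j := by
  have : ∀ j, ∃ t, j ∈ Set.Icc 1 n → t ∈ Set.Ioo (l j) (u j) ∧ p.eval t = 0 := by
    intro j
    by_cases hj : j ∈ Set.Icc 1 n
    · obtain ⟨t, ht⟩ := p.exists_eval_eq_zero_mem_Ioo _ (hlu j hj) (hl j hj) (hu j hj)
      exact ⟨t, fun _ => ht⟩
    · exact ⟨0, fun h => absurd h hj⟩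
  choose x hx using this
  refine ⟨x, hp.areOrderedZeros hn ?_ fun j hj => (hx j hj).2, fun j hj => (hx j hj).1⟩
  refine strictMonoOn_of_lt_add_one Set.ordConnected_Icc fun j _ hj hj' => ?_
  exact (hx j hj).1.2.trans ((hul j hj.1 hj'.2).trans_lt (hx _ hj').1.1)

theorem Polynomial.Monic.exists_gt_eval_pos {p : ℝ[X]} (hp : p.Monic) (hn : 0 < p.natDegree)
    (B : ℝ) : ∃ M, B < M ∧ 0 < p.eval M := by
  have h := p.tendsto_atTop_of_leadingCoeff_nonneg (natDegree_pos_iff_degree_pos.1 hn)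
    (by rw [hp.leadingCoeff]; exact zero_le_one)
  exact ((Filter.eventually_gt_atTop B).and (h.eventually_gt_atTop 0)).exists

/-- Reflection `X ↦ -X` reduces this to `exists_gt_eval_pos`. -/
theorem Polynomial.Monic.exists_lt_eval_sign {p : ℝ[X]} (hp : p.Monic) (hn : 0 < p.natDegree)
    (B : ℝ) : ∃ M, M < B ∧ 0 < (-1) ^ p.natDegree * p.eval M := by
  have hm : (C ((-1) ^ p.natDegree) * p.comp (-X)).Monic := by
    rw [Monic, leadingCoeff_mul, comp_neg_X_leadingCoeff_eq, hp.leadingCoeff, leadingCoeff_C,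
      mul_one, ← mul_pow]
    simp
  have hd : (C ((-1 : ℝ) ^ p.natDegree) * p.comp (-X)).natDegree = p.natDegree := by
    rw [natDegree_C_mul (pow_ne_zero _ (by norm_num)), natDegree_comp, natDegree_neg, natDegree_X,
      mul_one]
  obtain ⟨M, h1, h2⟩ := hm.exists_gt_eval_pos (by rwa [hd]) (-B)
  exact ⟨-M, by linarith, by simpa using h2⟩

theorem Polynomial.Monic.add_C_mul {p r : ℝ[X]} (hp : p.Monic) (c : ℝ)
    (h : r.natDegree < p.natDegree) :
    (p + C c * r).Monic ∧ (p + C c * r).natDegree = p.natDegree := by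
  have hl : (C c * r).natDegree < p.natDegree := (natDegree_C_mul_le _ _).trans_lt h
  exact ⟨hp.add_of_left (degree_lt_degree hl), natDegree_add_eq_left_of_natDegree_lt hl⟩

/-! ### Zeros of `p + c * r` for interlacing `p` and `r`. -/

section Interlacing
variable {p r : ℝ[X]} {m : ℕ} {x w : ℕ → ℝ}

theorem eval_sign_at_upper (hr : AreOrderedZeros r m w) (hrm : r.Monic)
    (hxw : ∀ j ∈ Set.Icc 1 m, x j < w j ∧ w j < x (j + 1)) {j : ℕ} (hj : j ∈ Set.Icc 1 (m + 1)) :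
    0 < (-1) ^ (m + 1 - j) * r.eval (x j) := by
  obtain ⟨i, rfl⟩ := Nat.exists_eq_add_of_le' hj.1
  have hi : i ≤ m := by have := hj.2; omega
  have := hr.sign_pos hrm (j := i) (t := x (i + 1)) hi (fun h => (hxw i ⟨h, hi⟩).2)
    fun h => (hxw (i + 1) ⟨by omega, h⟩).1
  rwa [Nat.add_sub_add_right]

theorem eval_sign_at_lower (hp : AreOrderedZeros p (m + 1) x) (hpm : p.Monic)
    (hxw : ∀ j ∈ Set.Icc 1 m, x j < w j ∧ w j < x (j + 1)) {j : ℕ} (hj : j ∈ Set.Icc 1 m) :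
    0 < (-1) ^ (m + 1 - j) * p.eval (w j) :=
  hp.sign_pos hpm (by have := hj.2; omega) (fun _ => (hxw j hj).1) fun _ => (hxw j hj).2

/-- The sum equals `c * r` at `x j` and `p` at `w j`, so it changes sign on each `(w (j - 1), x j)`
with `j ≥ 2`. The first zero lies in `(M, 0)`, where `M` is far to the left and `h0` gives the sign
at `0`. -/
theorem exists_zeros_add_pos_mul (hp : AreOrderedZeros p (m + 1) x) (hpm : p.Monic)
    (hr : AreOrderedZeros r m w) (hrm : r.Monic)
    (hxw : ∀ j ∈ Set.Icc 1 m, x j < w j ∧ w j < x (j + 1)) (hx : 0 < x 1) {c : ℝ} (hc : 0 < c)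
    (h0 : (-1) ^ (m + 1) * (p + C c * r).eval 0 < 0) :
    ∃ y, AreOrderedZeros (p + C c * r) (m + 1) y ∧ y 1 < 0 ∧
      (∀ j ∈ Set.Icc 1 m, w j < y (j + 1)) ∧ ∀ j ∈ Set.Icc 1 (m + 1), y j < x j := by
  obtain ⟨hm, hd⟩ := hpm.add_C_mul (r := r) c (by rw [hp.natDegree_eq, hr.natDegree_eq]; omega)
  rw [hp.natDegree_eq] at hd
  obtain ⟨M, hM, hMs⟩ := hm.exists_lt_eval_sign (by omega) 0
  rw [hd] at hMs
  have hxs := fun j hj => eval_sign_at_upper hr hrm hxw (j := j) hj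
  have hws := fun j hj => eval_sign_at_lower hp hpm hxw (j := j) hj
  obtain ⟨y, hy, hly⟩ := hm.exists_areOrderedZeros hd
    (fun j => if j = 1 then M else w (j - 1)) (fun j => if j = 1 then 0 else x j)
    (by
      intro j hj
      rcases eq_or_ne j 1 with rfl | h
      · simpa using hM
      · obtain ⟨i, rfl⟩ := Nat.exists_eq_add_of_le' hj.1
        have := hj.2
        have h' : i ≠ 0 := by omega
        simpa [h'] using (hxw i ⟨by omega, by omega⟩).2)
    (by
      intro j h1 h2
      have hj := hxw j ⟨h1, by omega⟩
      rcases eq_or_ne j 1 with rfl | h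
      · simpa using (hx.trans hj.1).le
      · have : j ≠ 0 := by omega
        simpa [h, this] using hj.1.le)
    (by
      intro j hj
      obtain ⟨i, rfl⟩ := Nat.exists_eq_add_of_le' hj.1
      have hi := hj.2
      rcases eq_or_ne i 0 with rfl | h
      · rw [pow_succ] at hMs
        simp only [zero_add, if_true, Nat.add_sub_cancel]
        linarith
      · have hw := hws i ⟨by omega, by omega⟩
        have hz := hr.eval_eq_zero (j := i) ⟨by omega, by omega⟩
        have e : m + 1 - i = m + 1 - (i + 1) + 1 := by omega
        rw [e, pow_succ] at hw
        simp only [Nat.add_eq_right, if_neg h, Nat.add_sub_cancel, eval_add, eval_mul, hz]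
        linarith)
    (by
      intro j hj
      rcases eq_or_ne j 1 with rfl | h
      · rw [pow_succ] at h0
        simp only [if_true, Nat.add_sub_cancel]
        linarith
      · have hz := hp.eval_eq_zero hj
        have := mul_pos hc (hxs j hj)
        simp only [if_neg h, eval_add, eval_mul, eval_C, hz]
        linarith)
  refine ⟨y, hy, by simpa using (hly 1 ⟨le_rfl, by omega⟩).2, fun j hj => ?_, fun j hj => ?_⟩
  · have h1 := hj.1
    have h : j ≠ 0 := by omega
    simpa [h] using (hly (j + 1) ⟨by omega, by have := hj.2; omega⟩).1
  · have := (hly j hj).2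
    rcases eq_or_ne j 1 with rfl | h
    · exact lt_trans (by simpa using this) hx
    · simpa [h] using this

/-- With `c < 0` the sign changes occur on `(x j, w j)` for `j ≤ m`, and the last one on `(1, M)`
with `M` large. -/
theorem exists_zeros_add_neg_mul (hp : AreOrderedZeros p (m + 1) x) (hpm : p.Monic)
    (hr : AreOrderedZeros r m w) (hrm : r.Monic)
    (hxw : ∀ j ∈ Set.Icc 1 m, x j < w j ∧ w j < x (j + 1)) (hx : x (m + 1) < 1) {c : ℝ}
    (hc : c < 0) (h1 : (p + C c * r).eval 1 < 0) :
    ∃ z, AreOrderedZeros (p + C c * r) (m + 1) z ∧ 1 < z (m + 1) ∧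
      (∀ j ∈ Set.Icc 1 m, z j < w j) ∧ ∀ j ∈ Set.Icc 1 (m + 1), x j < z j := by
  obtain ⟨hm, hd⟩ := hpm.add_C_mul (r := r) c (by rw [hp.natDegree_eq, hr.natDegree_eq]; omega)
  rw [hp.natDegree_eq] at hd
  obtain ⟨M, hM, hMs⟩ := hm.exists_gt_eval_pos (by omega) 1
  have hxs := fun j hj => eval_sign_at_upper hr hrm hxw (j := j) hj
  have hws := fun j hj => eval_sign_at_lower hp hpm hxw (j := j) hj
  obtain ⟨z, hz, hlz⟩ := hm.exists_areOrderedZeros hd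
    (fun j => if j = m + 1 then 1 else x j) (fun j => if j = m + 1 then M else w j)
    (by
      intro j hj
      rcases eq_or_ne j (m + 1) with rfl | h
      · simpa using hM
      · have := hj.2
        simpa [h] using (hxw j ⟨hj.1, by omega⟩).1)
    (by
      intro j h1 h2
      have hj := hxw j ⟨h1, by omega⟩
      rcases eq_or_ne j m with rfl | h
      · simpa using (hj.2.trans hx).le
      · simpa [h, h2.ne] using hj.2.le)
    (by
      intro j hj
      rcases eq_or_ne j (m + 1) with rfl | h
      · simpa using h1
      · have hz := hp.eval_eq_zero hj
        have := mul_neg_of_neg_of_pos hc (hxs j hj)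
        simp only [if_neg h, eval_add, eval_mul, eval_C, hz]
        linarith)
    (by
      intro j hj
      rcases eq_or_ne j (m + 1) with rfl | h
      · simpa using hMs
      · have hj' : j ∈ Set.Icc 1 m := ⟨hj.1, by have := hj.2; omega⟩
        have hw := hws j hj'
        have hz := hr.eval_eq_zero hj'
        simp only [if_neg h, eval_add, eval_mul, hz]
        linarith)
  refine ⟨z, hz, by simpa using (hlz (m + 1) ⟨by omega, le_rfl⟩).1, fun j hj => ?_,
    fun j hj => ?_⟩
  · have h : j ≠ m + 1 := by have := hj.2; omega
    simpa [h] using (hlz j ⟨hj.1, by have := hj.2; omega⟩).2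
  · have := (hlz j hj).1
    rcases eq_or_ne j (m + 1) with rfl | h
    · exact hx.trans (by simpa using this)
    · simpa [h] using this

end Interlacing

/-! ### Interlacing for little `q`-Jacobi polynomials and the main theorem. -/

/-- At a zero of the polynomial of degree `n + 1` the recurrence makes the values in degrees `n + 2`
and `n` have opposite signs. Hence the polynomial of degree `n + 2` alternates along these zeros,
and the ratios at `0` and `1` extend the alternation to both endpoints. -/
theorem littleQJacobi_interlacing {q α β : ℝ} (hq0 : 0 < q) (hq1 : q < 1) (hα0 : 0 < α * q)
    (hα1 : α * q < 1) (hβ0 : 0 < β * q) (hβ1 : β * q < 1) (n : ℕ) :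
    ∃ x w : ℕ → ℝ, AreOrderedZeros (littleQJacobi q α β (n + 1)) (n + 1) x ∧
      AreOrderedZeros (littleQJacobi q α β n) n w ∧ 0 < x 1 ∧ x (n + 1) < 1 ∧
      ∀ j ∈ Set.Icc 1 n, x j < w j ∧ w j < x (j + 1) := by
  have hmd := littleQJacobi_monic_natDegree hq0 hq1 hα0 hα1 hβ0 hβ1
  induction n with
  | zero =>
    refine ⟨fun _ => ljA q α β 0, fun _ => 0, (hmd _).1.areOrderedZeros (hmd _).2 ?_ ?_,
      (hmd _).1.areOrderedZeros (hmd _).2 ?_ ?_, ljA_pos hq0 hq1 hα0 hα1 hβ0 hβ1 0, ?_, ?_⟩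
    · intro i hi j hj hij
      have := hi.1
      have := hj.2
      omega
    · simp [littleQJacobi_one hq0 hq1 hα0 hα1 hβ0 hβ1]
    · exact fun i hi => absurd (hi.1.trans hi.2) (by norm_num)
    · simp
    · have h1 := littleQJacobi_eval_one_succ hq0 hq1 hα0 hα1 hβ0 hβ1 0
      have h2 := ljOne_pos hq0 hq1 hα0 hα1 hβ0 hβ1 0
      rw [zero_add, littleQJacobi_one hq0 hq1 hα0 hα1 hβ0 hβ1, littleQJacobi_zero] at h1
      simp only [eval_sub, eval_X, eval_C, eval_one, mul_one] at h1
      linarith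
    · simp
  | succ n ih =>
    obtain ⟨x, w, hx, hw, hx0, hx1, hxw⟩ := ih
    have hmono : ∀ j ∈ Set.Icc 1 n, x j < x (j + 1) := fun j hj =>
      (hxw j hj).1.trans (hxw j hj).2
    have hxs := fun j hj => eval_sign_at_upper hw (hmd n).1 hxw (j := j) hj
    -- The nodes `0, x 1, …, x (n + 1), 1`, which bound `n + 2` intervals, one for each new zero.
    set e : ℕ → ℝ := fun j => if j = 0 then 0 else if j = n + 2 then 1 else x j with he
    have e0 : e 0 = 0 := by simp [he]
    have e1 : e (n + 2) = 1 := by simp [he]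
    have ex : ∀ j ∈ Set.Icc 1 (n + 1), e j = x j := fun j hj => by
      have h1 : j ≠ 0 := by have := hj.1; omega
      have h2 : j ≠ n + 2 := by have := hj.2; omega
      simp [he, h1, h2]
    have hlt : ∀ j ≤ n + 1, e j < e (j + 1) := by
      intro j hj
      rcases eq_or_ne j 0 with rfl | h0
      · rwa [e0, ex _ ⟨le_rfl, by omega⟩]
      · rw [ex j ⟨by omega, hj⟩]
        rcases eq_or_ne j (n + 1) with rfl | h1
        · rwa [e1]
        · rw [ex (j + 1) ⟨by omega, by omega⟩]
          exact hmono j ⟨by omega, by omega⟩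
    have hs : ∀ j ≤ n + 2, 0 < (-1) ^ (n + 2 - j) * (littleQJacobi q α β (n + 2)).eval (e j) := by
      intro j hj
      rcases eq_or_ne j 0 with rfl | h0
      · have h := hx.sign_pos (hmd _).1 (j := 0) (t := 0) (by omega) (by omega) fun _ => hx0
        have hA := ljA_pos hq0 hq1 hα0 hα1 hβ0 hβ1 (n + 1)
        rw [e0, littleQJacobi_eval_zero_succ hq0 hq1 hα0 hα1 hβ0 hβ1, Nat.sub_zero,
          pow_succ (-1 : ℝ) (n + 1)]
        rw [Nat.sub_zero] at h
        have := mul_pos hA h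
        linarith
      · rcases eq_or_ne j (n + 2) with rfl | h1
        · have h := hx.sign_pos (hmd _).1 (j := n + 1) (t := 1) le_rfl (fun _ => hx1) (by omega)
          rw [e1, littleQJacobi_eval_one_succ hq0 hq1 hα0 hα1 hβ0 hβ1]
          simp only [Nat.sub_self, pow_zero, one_mul] at h ⊢
          exact mul_pos (ljOne_pos hq0 hq1 hα0 hα1 hβ0 hβ1 _) h
        · have hj' : j ∈ Set.Icc 1 (n + 1) := ⟨by omega, by omega⟩
          have h := hxs j hj'
          have hl := mul_pos (mul_pos (ljA_pos hq0 hq1 hα0 hα1 hβ0 hβ1 n)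
            (ljC_pos hq0 hq1 hα0 hα1 hβ0 hβ1 n)) h
          have hk : n + 2 - j = n + 1 - j + 1 := by omega
          rw [ex j hj', littleQJacobi_recurrence hq0 hq1 hα0 hα1 hβ0 hβ1, eval_sub, eval_mul,
            hx.eval_eq_zero hj', eval_mul, eval_C, hk, pow_succ]
          linarith
    obtain ⟨v, hv, hlv⟩ := (hmd (n + 2)).1.exists_areOrderedZeros (hmd (n + 2)).2
      (fun j => e (j - 1)) e
      (by
        intro j hj
        obtain ⟨i, rfl⟩ := Nat.exists_eq_add_of_le' hj.1
        have := hj.2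
        exact hlt i (by omega))
      (fun j _ _ => le_rfl)
      (by
        intro j hj
        obtain ⟨i, rfl⟩ := Nat.exists_eq_add_of_le' hj.1
        have hi := hj.2
        have h := hs i (by omega)
        have hk : n + 2 - i = n + 2 - (i + 1) + 1 := by omega
        rw [hk, pow_succ] at h
        rw [Nat.add_sub_cancel]
        linarith)
      (fun j hj => hs j hj.2)
    refine ⟨v, x, hv, hx, ?_, ?_, fun j hj => ⟨?_, ?_⟩⟩
    · simpa [e0] using (hlv 1 ⟨le_rfl, by omega⟩).1
    · simpa [e1] using (hlv (n + 2) ⟨by omega, le_rfl⟩).2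
    · have := (hlv j ⟨hj.1, by have := hj.2; omega⟩).2
      rwa [ex j hj] at this
    · have := (hlv (j + 1) ⟨by omega, by have := hj.2; omega⟩).1
      rwa [Nat.add_sub_cancel, ex j hj] at this

theorem theorem2p10 (q α β : ℝ) (hq0 : 0 < q) (hq1 : q < 1)
    (hα0 : 0 < α * q) (hα1 : α * q < 1) (hβ0 : 0 < β * q) (hβ1 : β * q < 1)
    (n : ℕ) (hn : 1 ≤ n) (hn1 : n = 1 → α * β * q < 1) :
    ∃ x w : ℕ → ℝ,
      AreOrderedZeros (littleQJacobi q α β n) n x ∧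
      AreOrderedZeros (littleQJacobi q α β (n - 1)) (n - 1) w ∧
      (1 < α → ∃ y : ℕ → ℝ, AreOrderedZeros (littleQJacobi q (α / q) β n) n y ∧
        y 1 < 0 ∧ 0 < x 1 ∧
        (∀ j ∈ Set.Icc 1 (n - 1), x j < w j ∧ w j < y (j + 1)) ∧
        (∀ j ∈ Set.Icc 1 n, y j < x j) ∧
        x n < 1) ∧
      (1 < β → ∃ z : ℕ → ℝ, AreOrderedZeros (littleQJacobi q α (β / q) n) n z ∧
        0 < x 1 ∧
        (∀ j ∈ Set.Icc 1 n, x j < z j) ∧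
        (∀ j ∈ Set.Icc 1 (n - 1), z j < w j ∧ w j < x (j + 1)) ∧
        x n < 1 ∧ 1 < z n) := by
  obtain ⟨m, rfl⟩ := Nat.exists_eq_add_of_le' hn
  rw [Nat.add_sub_cancel]
  -- The only use of the extra assumption for degree one; in higher degree the bound is automatic.
  have hE : α * β * q ^ (m + 1) < 1 := by
    rcases m with _ | m
    · simpa using hn1 rfl
    · have := one_sub_mul_pow_pos hq0 hq1 hα0 hα1 hβ0 hβ1 (m := m + 1 + 1) (by omega)
      linarith
  have hmd := littleQJacobi_monic_natDegree hq0 hq1 hα0 hα1 hβ0 hβ1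
  have hA := ljA_pos hq0 hq1 hα0 hα1 hβ0 hβ1 m
  obtain ⟨x, w, hx, hw, hx0, hx1, hxw⟩ := littleQJacobi_interlacing hq0 hq1 hα0 hα1 hβ0 hβ1 m
  refine ⟨x, w, hx, hw, fun hα => ?_, fun hβ => ?_⟩
  · have hκ := ljKappa_neg hq0 hq1 hα0 hα1 hβ0 hβ1 m hE hα
    rw [littleQJacobi_div_left hq0 hq1 hα0 hα1 hβ0 hβ1 m hE hα.ne']
    obtain ⟨y, hy, hy0, hwy, hyx⟩ := exists_zeros_add_pos_mul hx (hmd _).1 hw (hmd _).1 hxw hx0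
      (c := (1 - ljKappa q α β (m + 1)) * ljA q α β m) (mul_pos (by linarith) hA) (by
        have h := hx.sign_pos (hmd _).1 (j := 0) (t := 0) (by omega) (by omega) fun _ => hx0
        have h0 := littleQJacobi_eval_zero_succ hq0 hq1 hα0 hα1 hβ0 hβ1 m
        rw [Nat.sub_zero] at h
        have := mul_neg_of_neg_of_pos hκ h
        rw [eval_add, eval_mul, eval_C]
        -- At `0` the shifted polynomial is `ljKappa` times the original, and `ljKappa < 0` reverses
        -- the sign.
        have e : (littleQJacobi q α β (m + 1)).eval 0 + (1 - ljKappa q α β (m + 1)) *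
            ljA q α β m * (littleQJacobi q α β m).eval 0 =
            ljKappa q α β (m + 1) * (littleQJacobi q α β (m + 1)).eval 0 := by
          linear_combination (1 - ljKappa q α β (m + 1)) * h0
        rw [e]
        linarith)
    exact ⟨y, hy, hy0, hx0, fun j hj => ⟨(hxw j hj).1, hwy j hj⟩, hyx, hx1⟩
  · rw [littleQJacobi_div_right hq0 hq1 hα0 hα1 hβ0 hβ1 m hE]
    obtain ⟨z, hz, hz1, hzw, hxz⟩ := exists_zeros_add_neg_mul hx (hmd _).1 hw (hmd _).1 hxw hx1
      (c := (1 - ljMu q α β (m + 1)) * ljA q α β m)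
      (mul_neg_of_neg_of_pos (one_sub_ljMu_neg hq0 hq1 hα0 hβ0 m hE) hA) (by
        have h := hx.sign_pos (hmd _).1 (j := m + 1) (t := 1) le_rfl (fun _ => hx1) (by omega)
        have h1 := littleQJacobi_eval_one_succ hq0 hq1 hα0 hα1 hβ0 hβ1 m
        have hO := ljOne_pos hq0 hq1 hα0 hα1 hβ0 hβ1 m
        rw [Nat.sub_self, pow_zero, one_mul, h1] at h
        -- Positivity at `1` passes down to degree `m`, so the sign of the shifted polynomial there
        -- is that of the factor in `ljOne_add_neg`.
        have hpos := pos_of_mul_pos_right h hO.le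
        have := mul_neg_of_neg_of_pos
          (ljOne_add_neg hq0 hq1 hα0 hα1 hβ0 hβ1 m hE hβ) hpos
        rw [eval_add, eval_mul, eval_C, h1]
        linarith)
    exact ⟨z, hz, hx0, hxz, fun j hj => ⟨hzw j hj, (hxw j hj).2⟩, hx1, hz1⟩
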